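/- For an element $s$ of a finite semigroup, let $s^\omega$ denote the unique idempotent among the powers $s^n$ ($n\ge 1$). Let $\mathsf V_2$ and $\mathsf V_3$ be the pseudovarieties of all finite semigroups $S$ such that, for all $t,x,z\in S$, with $e=t^\omega$ and $f=z^\omega$, one has $$\mathsf V_2:\quad exf(ef)^\omega=exf,\qquad\qquad \mathsf V_3:\quad (ef)^\omega exf=exf .$$ For a subsemigroup $U$ of a semigroup $T$, the dominion $\mathrm{Dom}(U,T)$ is the set of all $d\in T$ such that $\alpha(d)=\beta(d)$ for every semigroup $W$ (finite or infinite) and all semigroup morphisms $\alpha,\beta:T\to W$ that agree on $U$. A finite semigroup $S$ is F-saturated if $\mathrm{Dom}(S,T)\neq T$ for every finite semigroup $T$ that contains $S$ as a proper subsemigroup; a class of finite semigroups is F-saturated if all its members are. A class $\mathcal C$ of finite semigroups is F-epimorphically closed if, for every epimorphism $S\to T$ in the category of all semigroups with $S\in\mathcal C$ and $T$ finite, one has $T\in\mathcal C$. Then each of the pseudovarieties $\mathsf V_2$ and $\mathsf V_3$ is F-saturated and F-epimorphically closed. -/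

import Mathlib

universe u

namespace FSat

/-- `posPow s n` is the power `s ^ (n + 1)` in a semigroup. -/
def posPow {S : Type u} [Semigroup S] (s : S) : ℕ → S
  | 0 => s
  | n + 1 => posPow s n * s

theorem posPow_mul {S : Type u} [Semigroup S] (s : S) (m n : ℕ) :
    posPow s m * posPow s n = posPow s (m + n + 1) := by
  induction n with
  | zero => rfl
  | succ n ih =>
    change posPow s m * (posPow s n * s) = posPow s (m + n + 1) * s
    rw [← mul_assoc, ih]

/-- In a finite semigroup every element has exactly one idempotent among its positive powers. -/
theorem existsUnique_idempotent_posPow {S : Type u} [Semigroup S] [Finite S] (s : S) :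
    ∃! e : S, IsIdempotentElem e ∧ ∃ n : ℕ, e = posPow s n := by
  have huniq : ∀ e f : S, (IsIdempotentElem e ∧ ∃ n : ℕ, e = posPow s n) →
      (IsIdempotentElem f ∧ ∃ n : ℕ, f = posPow s n) → e = f := by
    rintro e f ⟨he, m, hm⟩ ⟨hf, n, hn⟩
    -- every positive power of an idempotent `g = s ^ (k + 1)` is `g`
    have key : ∀ (g : S) (k : ℕ), IsIdempotentElem g → g = posPow s k →
        ∀ j : ℕ, posPow s (j * (k + 1) + k) = g := by
      intro g k hg hk j
      induction j with
      | zero => simpa using hk.symm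
      | succ j ih =>
        have h := posPow_mul s (j * (k + 1) + k) k
        rw [ih, ← hk, hg.eq] at h
        rw [h]
        congr 1
        ring
    have h1 := key e m he hm n
    have h2 := key f n hf hn m
    rw [← h1, ← h2]
    congr 1
    ring
  have hex : ∃ e : S, IsIdempotentElem e ∧ ∃ n : ℕ, e = posPow s n := by
    obtain ⟨a, b, hab, h⟩ := Finite.exists_ne_map_eq_of_infinite (posPow s)
    wlog hlt : a < b generalizing a b
    · exact this b a hab.symm h.symm (by omega)
    obtain ⟨p, rfl⟩ : ∃ p, b = a + p + 1 := ⟨b - a - 1, by omega⟩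
    have step : ∀ c : ℕ, posPow s (a + c + (p + 1)) = posPow s (a + c) := by
      intro c
      induction c with
      | zero => exact h.symm
      | succ c ih =>
        have e1 : a + (c + 1) + (p + 1) = (a + c + (p + 1)) + 1 := by ring
        rw [e1]
        change posPow s (a + c + (p + 1)) * s = posPow s (a + c) * s
        rw [ih]
    have steps : ∀ j c : ℕ, posPow s (a + c + j * (p + 1)) = posPow s (a + c) := by
      intro j c
      induction j with
      | zero => simp
      | succ j ih =>
        have e1 : a + c + (j + 1) * (p + 1) = a + (c + j * (p + 1)) + (p + 1) := by ring
        have e2 : a + (c + j * (p + 1)) = a + c + j * (p + 1) := by ring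
        rw [e1, step, e2, ih]
    refine ⟨posPow s ((a + 1) * (p + 1) - 1), ?_, _, rfl⟩
    have hk : (a + 1) * (p + 1) = a + (a * p + p) + 1 := by ring
    change _ * _ = _
    rw [posPow_mul, hk]
    have e3 : a + (a * p + p) + 1 - 1 + (a + (a * p + p) + 1 - 1) + 1
        = a + (a * p + p) + (a + 1) * (p + 1) := by
      rw [hk]; omega
    rw [e3, steps]
    congr 1
  obtain ⟨e, he⟩ := hex
  exact ⟨e, he, fun f hf => huniq f e hf he⟩

/-- The `ω`-power of an element of a finite semigroup: its only idempotent positive power. -/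
noncomputable def omega {S : Type u} [Semigroup S] [Finite S] (s : S) : S :=
  (existsUnique_idempotent_posPow s).choose

/-- The dominion of a subsemigroup `U` of `S`; the two morphisms range over all pairs of
semigroup morphisms from `S` into a common, arbitrary (possibly infinite) semigroup. -/
def dominion {S : Type u} [Semigroup S] (U : Subsemigroup S) : Set S :=
  {d | ∀ (T : Type u) [Semigroup T] (α β : S →ₙ* T),
    (∀ x ∈ U, α x = β x) → α d = β d}

/-- A semigroup is F-saturated if it is not epimorphically embedded as a proper subsemigroup
in any finite semigroup. -/
def FSaturated (S : Type u) [Semigroup S] : Prop :=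
  ∀ (T : Type u) [Semigroup T] [Finite T] (ι : S →ₙ* T),
    Function.Injective ι → ¬ Function.Surjective ι → dominion ι.srange ≠ Set.univ

/-- A class of semigroups is F-saturated if all its members are. -/
def FSaturatedClass (C : CategoryTheory.ObjectProperty Semigrp.{u}) : Prop :=
  ∀ S : Semigrp.{u}, C S → FSaturated S

/-- A class of finite semigroups is F-epimorphically closed if it contains every finite
semigroup that is the codomain of an epimorphism (in the category of all semigroups) from a
member of the class. -/
def FEpiClosed (C : CategoryTheory.ObjectProperty Semigrp.{u}) : Prop :=
  ∀ (S T : Semigrp.{u}) (φ : S ⟶ T), Finite T → CategoryTheory.Epi φ → C S → C T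

/-- The finite semigroups satisfying `e x f (e f)^ω = e x f`, where `e = t^ω`, `f = z^ω`. -/
def V₂ : CategoryTheory.ObjectProperty Semigrp.{u} := fun S =>
  ∃ _ : Finite S, ∀ t x z : S,
    omega t * x * omega z * omega (omega t * omega z) = omega t * x * omega z

/-- The finite semigroups satisfying `(e f)^ω e x f = e x f`, where `e = t^ω`, `f = z^ω`. -/
def V₃ : CategoryTheory.ObjectProperty Semigrp.{u} := fun S =>
  ∃ _ : Finite S, ∀ t x z : S,
    omega (omega t * omega z) * omega t * x * omega z = omega t * x * omega z

end FSat

namespace FSat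

/-! ### Powers and `ω`-powers -/

section Omega

variable {S T : Type u} [Semigroup S] [Semigroup T]

/-! Both assertions reduce to one: a morphism from a member of either class to a finite semigroup
`T`, whose image `U` dominates `T`, is onto. Closure under epimorphisms follows because quotients
inherit the laws. If `U ≠ T`, every `d ∉ U` factors as `x * u * y` with `u` and `u * y` in `U` but
`x`, `y` outside, and dually with `x * u` in `U`; otherwise an integer-valued indicator function
gives two morphisms separating `d` from `U` (`balanced_of_mem_dominion`). Take `d ∉ U` with maximal
principal ideal `K`. Finiteness refines the factorization so that `x * f = x` and `e * y = y` for
idempotents `e`, `f` of `U` generating `K`, and `u = f * v * e`. Either law puts `u` below `i = (f *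
e)^ω`, and stability then makes `u` a unit of the local monoid of `i`. Inverting it recovers `y`
from `u * y` inside `U`, a contradiction (`eq_empty_of_factorizations`). -/

theorem map_posPow (φ : S →ₙ* T) (s : S) (n : ℕ) : φ (posPow s n) = posPow (φ s) n := by
  induction n with
  | zero => rfl
  | succ n ih => exact (map_mul φ _ _).trans (by rw [ih]; rfl)

theorem coe_posPow (s : S) (n : ℕ) : ((posPow s n : S) : WithOne S) = (s : WithOne S) ^ (n + 1) := by
  induction n with
  | zero => simp [posPow]
  | succ n ih => rw [pow_succ, ← ih]; rfl

variable [Finite S] [Finite T]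

theorem omega_isIdempotentElem (s : S) : IsIdempotentElem (omega s) :=
  (existsUnique_idempotent_posPow s).choose_spec.1.1

theorem omega_eq_posPow (s : S) : ∃ n : ℕ, omega s = posPow s n :=
  (existsUnique_idempotent_posPow s).choose_spec.1.2

theorem eq_omega {s e : S} (he : IsIdempotentElem e) (hn : ∃ n : ℕ, e = posPow s n) :
    e = omega s :=
  (existsUnique_idempotent_posPow s).choose_spec.2 e ⟨he, hn⟩

theorem omega_eq_self {e : S} (he : IsIdempotentElem e) : omega e = e :=
  (eq_omega he ⟨0, rfl⟩).symm

theorem map_omega (φ : S →ₙ* T) (s : S) : φ (omega s) = omega (φ s) := by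
  refine eq_omega ?_ ?_
  · rw [IsIdempotentElem, ← map_mul, (omega_isIdempotentElem s).eq]
  · obtain ⟨n, hn⟩ := omega_eq_posPow s
    exact ⟨n, by rw [hn, map_posPow]⟩

end Omega

/-! ### Separating morphisms and dominions -/

/-- The semidirect-type extension of `T` by the integer-valued functions on pairs, on which `T`
acts on the left through the first and on the right through the second argument. -/
@[ext]
structure PairExt (T : Type u) where
  base : T
  fn : WithOne T → WithOne T → ℤ

instance (T : Type u) [Semigroup T] : Semigroup (PairExt T) where
  mul p q := ⟨p.base * q.base, fun a b => q.fn (a * p.base) b + p.fn a (q.base * b)⟩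
  mul_assoc p q r := by
    ext a b
    · exact mul_assoc _ _ _
    · change r.fn (a * ((p.base * q.base : T) : WithOne T)) b
          + (q.fn (a * p.base) (r.base * b) + p.fn a (q.base * (r.base * b)))
        = (r.fn (a * p.base * q.base) b + q.fn (a * p.base) (r.base * b))
          + p.fn a (((q.base * r.base : T) : WithOne T) * b)
      simp only [WithOne.coe_mul, mul_assoc, add_assoc]

/-- The extension of `T` by the inner derivation given by `g`. -/
def innerDerivation {T : Type u} [Semigroup T] (g : WithOne T → WithOne T → ℤ) :
    T →ₙ* PairExt T where
  toFun t := ⟨t, fun a b => g (a * t) b - g a (t * b)⟩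
  map_mul' s t := by
    ext a b
    · rfl
    · change g (a * ((s * t : T) : WithOne T)) b - g a (((s * t : T) : WithOne T) * b)
        = (g (a * s * t) b - g (a * s) (t * b)) + (g (a * s) (t * b) - g a (s * (t * b)))
      simp only [WithOne.coe_mul, mul_assoc]
      ring

/-- A function on pairs that is balanced over `U` is balanced over the dominion of `U`. -/
theorem balanced_of_mem_dominion {T : Type u} [Semigroup T] {U : Subsemigroup T} {d : T}
    (hd : d ∈ dominion U) (g : WithOne T → WithOne T → ℤ)
    (hg : ∀ s ∈ U, ∀ a b, g (a * s) b = g a (s * b)) : g d 1 = g 1 d := by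
  -- Balance over `U` says that the derivation of `g` vanishes on `U`, so it agrees there with the
  -- zero derivation.
  have h := hd (PairExt T) (innerDerivation g) (innerDerivation fun _ _ => 0) fun s hs => by
    ext a b
    · rfl
    · change g (a * s) b - g a (s * b) = 0 - 0
      rw [hg s hs, sub_self, sub_self]
  have h' : g (1 * d) 1 - g 1 (d * 1) = 0 - 0 := congrFun (congrFun (congrArg PairExt.fn h) 1) 1
  rw [one_mul, mul_one] at h'
  linarith

/-- The image of a subsemigroup in the semigroup with an identity adjoined. -/
abbrev withOneImage {T : Type u} [Semigroup T] (U : Subsemigroup T) :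
    Subsemigroup (WithOne T) := U.map WithOne.coeMulHom

section Factorization

variable {T : Type u} [Semigroup T] {U : Subsemigroup T} {d : T}

/-- The last link of a zigzag. -/
theorem exists_factorization_right (hd : d ∈ dominion U) (hdU : d ∉ U) :
    ∃ x u y : WithOne T, (d : WithOne T) = x * u * y ∧ u ∈ withOneImage U ∧
      u * y ∈ withOneImage U ∧ (x ≠ 1 ∧ x ∉ withOneImage U) ∧ (y ≠ 1 ∧ y ∉ withOneImage U) := by
  classical
  have hd' : (d : WithOne T) ∉ withOneImage U := by
    rintro ⟨s, hs, h⟩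
    exact hdU (WithOne.coe_inj.1 h ▸ hs)
  by_contra! hcon
  have h := balanced_of_mem_dominion hd
    (fun a b => if a * b = d ∧ (b = 1 ∨ b ∈ withOneImage U) then 1 else 0) ?_
  · simp [hd', WithOne.coe_ne_one] at h
  · intro s hs a b
    have hs' : (s : WithOne T) ∈ withOneImage U := ⟨s, hs, rfl⟩
    refine if_congr ?_ rfl rfl
    rw [mul_assoc]
    refine and_congr_right fun hab => ⟨?_, fun hsb => ?_⟩
    · rintro (rfl | hb)
      · exact Or.inr (by rwa [mul_one])
      · exact Or.inr (mul_mem hs' hb)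
    · have hsb : (s : WithOne T) * b ∈ withOneImage U := by
        refine hsb.resolve_left fun h1 => ?_
        cases b with
        | one => simp at h1
        | coe b => exact WithOne.coe_ne_one (a := s * b) (by simpa using h1)
      by_contra! hb
      refine hb.2 (hcon a s b (by rw [mul_assoc, hab]) hs' hsb ⟨?_, ?_⟩ hb.1)
      · rintro rfl
        exact hd' (by rw [← hab, one_mul]; exact hsb)
      · intro ha
        exact hd' (by rw [← hab]; exact mul_mem ha hsb)

/-- The first link of a zigzag. -/
theorem exists_factorization_left (hd : d ∈ dominion U) (hdU : d ∉ U) :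
    ∃ x u y : WithOne T, (d : WithOne T) = x * u * y ∧ u ∈ withOneImage U ∧
      x * u ∈ withOneImage U ∧ (x ≠ 1 ∧ x ∉ withOneImage U) ∧ (y ≠ 1 ∧ y ∉ withOneImage U) := by
  classical
  have hd' : (d : WithOne T) ∉ withOneImage U := by
    rintro ⟨s, hs, h⟩
    exact hdU (WithOne.coe_inj.1 h ▸ hs)
  by_contra! hcon
  -- This indicator is 1 at `(d, 1)` and 0 at `(1, d)`, so it cannot be balanced; a failure of
  -- balance at `(a, s, b)` is exactly the wanted factorization.
  have h := balanced_of_mem_dominion hd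
    (fun a b => if a * b = d ∧ (a = 1 ∨ a ∈ withOneImage U) then 1 else 0) ?_
  · simp [hd', WithOne.coe_ne_one] at h
  · intro s hs a b
    have hs' : (s : WithOne T) ∈ withOneImage U := ⟨s, hs, rfl⟩
    refine if_congr ?_ rfl rfl
    rw [← mul_assoc]
    refine and_congr_right fun hab => ⟨fun hsa => ?_, ?_⟩
    · have hsa : a * (s : WithOne T) ∈ withOneImage U := by
        refine hsa.resolve_left fun h1 => ?_
        cases a with
        | one => simp at h1
        | coe a => exact WithOne.coe_ne_one (a := a * s) (by simpa using h1)
      by_contra! ha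
      refine hd' ?_
      rw [← hab]
      by_cases hb : b = 1
      · rwa [hb, mul_one]
      · exact mul_mem hsa (hcon a s b hab.symm hs' hsa ha hb)
    · rintro (rfl | ha)
      · exact Or.inr (by rwa [one_mul])
      · exact Or.inr (mul_mem ha hs')

end Factorization

/-! ### Principal ideals of a finite monoid -/

section Ideals

variable {M : Type u} [Monoid M]

/-- The two-sided principal ideal generated by an element of a monoid. -/
def principalIdeal (x : M) : Set M := {z | ∃ a b, z = a * x * b}

theorem mem_principalIdeal_self (x : M) : x ∈ principalIdeal x := ⟨1, 1, by simp⟩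

theorem principalIdeal_subset {x z : M} (h : z ∈ principalIdeal x) :
    principalIdeal z ⊆ principalIdeal x := by
  obtain ⟨a, b, rfl⟩ := h
  rintro _ ⟨c, d, rfl⟩
  exact ⟨c * a, b * d, by simp only [mul_assoc]⟩

theorem principalIdeal_mul_subset_left (x y : M) :
    principalIdeal (x * y) ⊆ principalIdeal x :=
  principalIdeal_subset ⟨1, y, by simp⟩

theorem principalIdeal_mul_subset_right (x y : M) :
    principalIdeal (x * y) ⊆ principalIdeal y :=
  principalIdeal_subset ⟨x, 1, by simp⟩

/-- The factor `s` covers `n = 0`, where `u ^ 0 = 1` need not lie in `S`. -/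
theorem mul_pow_mem {S : Subsemigroup M} {s u : M} (hs : s ∈ S) (hu : u ∈ S) (n : ℕ) :
    s * u ^ n ∈ S := by
  induction n with
  | zero => simpa
  | succ n ih => rw [pow_succ, ← mul_assoc]; exact mul_mem ih hu

theorem pow_succ_mem {S : Subsemigroup M} {u : M} (hu : u ∈ S) (n : ℕ) : u ^ (n + 1) ∈ S := by
  rw [pow_succ']
  exact mul_pow_mem hu hu n

theorem eq_pow_mul_mul_pow {x a b : M} (h : x = a * x * b) (n : ℕ) : x = a ^ n * x * b ^ n := by
  induction n with
  | zero => simp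
  | succ n ih =>
    calc x = a ^ n * x * b ^ n := ih
      _ = a ^ n * (a * x * b) * b ^ n := by rw [← h]
      _ = a ^ (n + 1) * x * b ^ (n + 1) := by rw [pow_succ a, pow_succ' b]; simp only [mul_assoc]

variable [Finite M]

theorem exists_isIdempotentElem_pow (x : M) : ∃ n : ℕ, IsIdempotentElem (x ^ (n + 1)) := by
  obtain ⟨e, ⟨he, n, hn⟩, -⟩ := existsUnique_idempotent_posPow x
  refine ⟨n, ?_⟩
  have : ∀ n, posPow x n = x ^ (n + 1) := fun n => by
    induction n with
    | zero => simp [posPow]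
    | succ n ih => rw [pow_succ, ← ih]; rfl
  rwa [← this, ← hn]

/-- Stability of finite monoids, left version. -/
theorem exists_eq_mul_of_mem_principalIdeal {x c : M} (h : x ∈ principalIdeal (c * x)) :
    ∃ t, x = t * (c * x) := by
  obtain ⟨a, b, hab⟩ := h
  have h1 : x = a * c * x * b := by simpa only [mul_assoc] using hab
  -- Iterating `x = (a * c) * x * b` up to an idempotent power of `a * c` shows that this power
  -- fixes `x`.
  obtain ⟨n, hn⟩ := exists_isIdempotentElem_pow (a * c)
  have h2 := eq_pow_mul_mul_pow h1 (n + 1)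
  have h3 : (a * c) ^ (n + 1) * x = x := by
    conv_lhs => rw [h2]
    rw [← mul_assoc, ← mul_assoc, hn.eq, ← h2]
  refine ⟨(a * c) ^ n * a, ?_⟩
  conv_lhs => rw [← h3, pow_succ]
  simp only [mul_assoc]

/-- Stability of finite monoids, right version. -/
theorem exists_eq_mul_of_mem_principalIdeal' {x c : M} (h : x ∈ principalIdeal (x * c)) :
    ∃ t, x = x * c * t := by
  obtain ⟨a, b, hab⟩ := h
  have h1 : x = a * x * (c * b) := by simpa only [mul_assoc] using hab
  obtain ⟨n, hn⟩ := exists_isIdempotentElem_pow (c * b)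
  have h2 := eq_pow_mul_mul_pow h1 (n + 1)
  have h3 : x * (c * b) ^ (n + 1) = x := by
    conv_lhs => rw [h2]
    rw [mul_assoc, hn.eq, ← h2]
  refine ⟨b * (c * b) ^ n, ?_⟩
  conv_lhs => rw [← h3, pow_succ']
  simp only [mul_assoc]

/-- An element of the local monoid of an idempotent `i` that generates the same ideal as `i` is
a unit of this local monoid. -/
theorem exists_pow_eq_of_mem_principalIdeal {u i : M} (hiu : i * u = u) (hui : u * i = u)
    (h : i ∈ principalIdeal u) : ∃ n : ℕ, u ^ (n + 1) = i := by
  obtain ⟨t, ht⟩ := exists_eq_mul_of_mem_principalIdeal (x := i) (c := u) (by rwa [hui])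
  rw [hui] at ht
  obtain ⟨n, hn⟩ := exists_isIdempotentElem_pow u
  refine ⟨n, ?_⟩
  have h1 : i = t * i * u := by rw [mul_assoc, hiu, ← ht]
  have h2 : i = t ^ (n + 1) * u ^ (n + 1) := by
    have := eq_pow_mul_mul_pow h1 (n + 1)
    rwa [mul_assoc, pow_succ' u, ← mul_assoc i, hiu, ← pow_succ'] at this
  calc u ^ (n + 1) = i * u ^ (n + 1) := by rw [pow_succ', ← mul_assoc, hiu]
    _ = t ^ (n + 1) * (u ^ (n + 1) * u ^ (n + 1)) := by
        conv_lhs => rw [h2]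
        rw [mul_assoc]
    _ = i := by rw [hn.eq, ← h2]

end Ideals

/-- For a transitive and serial relation on a finite type, every element is related to a
reflexive one. -/
theorem exists_rel_self {α : Type*} [Finite α] (r : α → α → Prop)
    (htrans : ∀ a b c, r a b → r b c → r a c) (hserial : ∀ a, ∃ b, r a b) (a : α) :
    ∃ b, r a b ∧ r b b := by
  by_contra! hcon
  -- Without a reflexive point, the reversed relation is well-founded, yet seriality gives a minimal
  -- element a successor.
  let q : α → α → Prop := fun y x => r a x ∧ r x y
  have : IsTrans α q := ⟨fun z y x hzy hyx => ⟨hyx.1, htrans _ _ _ hyx.2 hzy.2⟩⟩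
  have : Std.Irrefl q := ⟨fun x hx => hcon x hx.1 hx.2⟩
  obtain ⟨m, hm, hmin⟩ := (Finite.wellFounded_of_trans_of_irrefl q).has_min {x | r a x} (hserial a)
  obtain ⟨b, hb⟩ := hserial m
  exact hmin b (htrans _ _ _ hm hb) ⟨hm, hb⟩

/-! ### The main argument -/

section Main

variable {M : Type u} [Monoid M] [Finite M]

/-- Let `D` be a set of elements outside a subsemigroup `S` of a finite monoid, all of whose
elements are zigzag-like factorizable. If `e x f` lies in the ideal generated by `(e f)^ω` for
all `x`, `e = e²` and `f = f²` in `S`, then `D` is empty. -/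
theorem eq_empty_of_factorizations (S : Subsemigroup M) (D : Set M) (hSD : ∀ x ∈ D, x ∉ S)
    (hright : ∀ d ∈ D, ∃ x u y, d = x * u * y ∧ u ∈ S ∧ u * y ∈ S ∧ x ∈ D ∧ y ∈ D)
    (hleft : ∀ d ∈ D, ∃ x u y, d = x * u * y ∧ u ∈ S ∧ x * u ∈ S ∧ x ∈ D ∧ y ∈ D)
    (hlaw : ∀ e ∈ S, ∀ f ∈ S, ∀ x ∈ S, IsIdempotentElem e → IsIdempotentElem f →
      ∃ n : ℕ, IsIdempotentElem ((e * f) ^ (n + 1)) ∧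
        e * x * f ∈ principalIdeal ((e * f) ^ (n + 1))) : D = ∅ := by
  by_contra hne
  -- By maximality, every factor of `d` that lies in `D` generates the same ideal `K`.
  obtain ⟨d, hdD, hmax⟩ := (Set.toFinite D).exists_maximalFor principalIdeal D
    (Set.nonempty_iff_ne_empty.2 hne)
  set K := principalIdeal d with hK
  have hD : ∀ x ∈ D, d ∈ principalIdeal x → principalIdeal x = K := fun x hx hdx =>
    (hmax hx (principalIdeal_subset hdx)).antisymm (principalIdeal_subset hdx)
  have hself : ∀ {x}, principalIdeal x = K → d ∈ principalIdeal x := fun hx => by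
    rw [hx]; exact mem_principalIdeal_self d
  let DK := {x // x ∈ D ∧ principalIdeal x = K}
  have hL : ∀ y : DK, ∃ z : DK, (∃ s ∈ S, y.1 = s * z.1) ∧ ∃ e ∈ S, IsIdempotentElem e ∧
      e * z.1 = z.1 ∧ principalIdeal e = K := by
    intro y
    -- Repeatedly splitting off left factors from `S` must reach some `z = w * z`; an idempotent
    -- power of `w` is then the required `e`.
    obtain ⟨z, ⟨s, hs, -, hyz⟩, w, hw, hwK, hz⟩ := exists_rel_self
      (fun y z : DK => ∃ s ∈ S, principalIdeal s ⊆ K ∧ y.1 = s * z.1)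
      (by
        rintro a b c ⟨s, hs, hsK, hab⟩ ⟨t, ht, -, hbc⟩
        exact ⟨s * t, mul_mem hs ht, (principalIdeal_mul_subset_left s t).trans hsK,
          by rw [hab, hbc, mul_assoc]⟩)
      (by
        rintro ⟨a, haD, haK⟩
        obtain ⟨x, u, z, rfl, -, hxu, hx, hz⟩ := hleft a haD
        have hd := hself haK
        refine ⟨⟨z, hz, hD z hz (principalIdeal_mul_subset_right _ _ hd)⟩, x * u, hxu, ?_, rfl⟩
        rw [← hD x hx (principalIdeal_mul_subset_left x u (principalIdeal_mul_subset_left _ _ hd))]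
        exact principalIdeal_mul_subset_left x u) y
    refine ⟨z, ⟨s, hs, hyz⟩, ?_⟩
    obtain ⟨n, hn⟩ := exists_isIdempotentElem_pow w
    have hwz : ∀ k : ℕ, w ^ k * z.1 = z.1 := fun k => by
      induction k with
      | zero => simp
      | succ k ih => rw [pow_succ, mul_assoc, ← hz, ih]
    refine ⟨w ^ (n + 1), pow_succ_mem hw n, hn, hwz _, Set.Subset.antisymm ?_ ?_⟩
    · rw [pow_succ]
      exact (principalIdeal_mul_subset_right _ _).trans hwK
    · rw [← z.2.2]
      conv_lhs => rw [← hwz (n + 1)]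
      exact principalIdeal_mul_subset_left _ _
  have hR : ∀ y : DK, ∃ z : DK, (∃ s ∈ S, y.1 = z.1 * s) ∧ ∃ e ∈ S, IsIdempotentElem e ∧
      z.1 * e = z.1 ∧ principalIdeal e = K := by
    intro y
    obtain ⟨z, ⟨s, hs, -, hyz⟩, w, hw, hwK, hz⟩ := exists_rel_self
      (fun y z : DK => ∃ s ∈ S, principalIdeal s ⊆ K ∧ y.1 = z.1 * s)
      (by
        rintro a b c ⟨s, hs, hsK, hab⟩ ⟨t, ht, -, hbc⟩
        exact ⟨t * s, mul_mem ht hs, (principalIdeal_mul_subset_right t s).trans hsK,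
          by rw [hab, hbc, mul_assoc]⟩)
      (by
        rintro ⟨a, haD, haK⟩
        obtain ⟨x, u, z, rfl, -, huz, hx, hz⟩ := hright a haD
        have hd := hself haK
        refine ⟨⟨x, hx, hD x hx (principalIdeal_mul_subset_left _ _
          (principalIdeal_mul_subset_left _ _ hd))⟩, u * z, huz, ?_, mul_assoc _ _ _⟩
        rw [← hD z hz (principalIdeal_mul_subset_right _ _ hd)]
        exact principalIdeal_mul_subset_right u z) y
    refine ⟨z, ⟨s, hs, hyz⟩, ?_⟩
    obtain ⟨n, hn⟩ := exists_isIdempotentElem_pow w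
    have hwz : ∀ k : ℕ, z.1 * w ^ k = z.1 := fun k => by
      induction k with
      | zero => simp
      | succ k ih => rw [pow_succ', ← mul_assoc, ← hz, ih]
    refine ⟨w ^ (n + 1), pow_succ_mem hw n, hn, hwz _, Set.Subset.antisymm ?_ ?_⟩
    · rw [pow_succ]
      exact (principalIdeal_mul_subset_right _ _).trans hwK
    · rw [← z.2.2]
      conv_lhs => rw [← hwz (n + 1)]
      exact principalIdeal_mul_subset_right _ _
  obtain ⟨x₀, u₀, y₀, hd₀, hu₀, huy₀, hx₀, hy₀⟩ := hright d hdD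
  have hdd : d ∈ principalIdeal (x₀ * u₀ * y₀) := by
    rw [← hd₀]; exact mem_principalIdeal_self d
  obtain ⟨⟨x, hx, hxK⟩, ⟨t, ht, hxt⟩, f, hf, hff, hxf, hfK⟩ := hR ⟨x₀, hx₀, hD x₀ hx₀
    (principalIdeal_mul_subset_left _ _ (principalIdeal_mul_subset_left _ _ hdd))⟩
  obtain ⟨⟨y, hy, hyK⟩, ⟨s, hs, hys⟩, e, he, hee, hey, heK⟩ := hL ⟨y₀, hy₀, hD y₀ hy₀
    (principalIdeal_mul_subset_right _ _ hdd)⟩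
  dsimp only at hxt hxf hys hey
  obtain ⟨v, hv⟩ : ∃ v, v = t * u₀ * s := ⟨_, rfl⟩
  have hvS : v ∈ S := hv ▸ mul_mem (mul_mem ht hu₀) hs
  -- The idempotents are absorbed by `x` and `y`, so the middle factor takes the form to which the
  -- law for the pair `(f, e)` applies.
  obtain ⟨u, hu⟩ : ∃ u, u = f * v * e := ⟨_, rfl⟩
  have huS : u ∈ S := hu ▸ mul_mem (mul_mem hf hvS) he
  have huy : u * y ∈ S := by
    have : u * y = f * (t * (u₀ * y₀)) := by rw [hu, hv, hys]; simp only [mul_assoc, hey]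
    rw [this]
    exact mul_mem hf (mul_mem ht huy₀)
  have hfu : f * u = u := by rw [hu, ← mul_assoc, ← mul_assoc, hff.eq]
  have hue : u * e = u := by rw [hu, mul_assoc, hee.eq]
  have hdu : d = x * u * y := by
    calc d = x * t * u₀ * (s * y) := by rw [← hxt, ← hys]; exact hd₀
      _ = (x * f) * v * (e * y) := by rw [hxf, hey, hv]; simp only [mul_assoc]
      _ = x * u * y := by rw [hu]; simp only [mul_assoc]
  obtain ⟨n, hi, hui⟩ := hlaw f hf e he v hvS hff hee
  rw [← hu] at hui
  set i := (f * e) ^ (n + 1) with hidef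
  have hKu : K ⊆ principalIdeal u := by
    rw [hK]
    exact principalIdeal_subset ⟨x, y, hdu⟩
  have hKi : K ⊆ principalIdeal i := hKu.trans (principalIdeal_subset hui)
  have hie : i = (f * e) ^ n * f * e := by rw [hidef, pow_succ, mul_assoc]
  have hif : i = f * (e * (f * e) ^ n) := by rw [hidef, pow_succ', mul_assoc]
  -- Since `i` is a left multiple of `e` and `e` lies in the ideal of `i`, stability makes `e` a
  -- left multiple of the idempotent `i`.
  have hei : e * i = e := by
    obtain ⟨c, hc⟩ := exists_eq_mul_of_mem_principalIdeal (x := e) (c := (f * e) ^ n * f)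
      (by rw [← hie]; exact hKi (heK ▸ mem_principalIdeal_self e))
    rw [← hie] at hc
    rw [hc, mul_assoc, hi.eq]
  have hif' : i * f = f := by
    obtain ⟨c, hc⟩ := exists_eq_mul_of_mem_principalIdeal' (x := f) (c := e * (f * e) ^ n)
      (by rw [← hif]; exact hKi (hfK ▸ mem_principalIdeal_self f))
    rw [← hif] at hc
    rw [hc, ← mul_assoc, hi.eq]
  have hiK : i ∈ K := by
    have h : i ∈ principalIdeal f := ⟨1, e * (f * e) ^ n, by rw [one_mul]; exact hif⟩
    rwa [hfK] at h
  obtain ⟨k, hk⟩ := exists_pow_eq_of_mem_principalIdeal (u := u) (i := i)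
    (by conv_lhs => rw [← hfu, ← mul_assoc, hif', hfu])
    (by conv_lhs => rw [← hue, mul_assoc, hei, hue]) (hKu hiK)
  refine hSD y hy ?_
  -- Here `u ^ k` acts as the inverse of `u`; the leading `e` keeps the product in `S` even when `k
  -- = 0`.
  have hyS : y = e * u ^ k * (u * y) := by
    calc y = e * i * y := by rw [hei, hey]
      _ = e * u ^ k * (u * y) := by rw [← hk, pow_succ]; simp only [mul_assoc]
  rw [hyS]
  exact mul_mem (mul_pow_mem he huS k) huy

end Main

/-- If `(e f)^ω` divides `e x f` for all elements `x` and idempotents `e`, `f` of `S`, then every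
morphism from `S` to a finite semigroup whose image is a dominating subsemigroup is onto. -/
theorem surjective_of_dominion_eq_univ {S T : Type u} [Semigroup S] [Finite S] [Semigroup T]
    [Finite T] (φ : S →ₙ* T) (hφ : dominion φ.srange = Set.univ)
    (hlaw : ∀ t x z : S, ((omega t * x * omega z : S) : WithOne S) ∈
      principalIdeal ((omega (omega t * omega z) : S) : WithOne S)) :
    Function.Surjective φ := by
  have : Finite (WithOne T) := inferInstanceAs (Finite (Option T))
  have hdom : ∀ d : T, d ∈ dominion φ.srange := fun d => hφ ▸ Set.mem_univ d
  have hD : ∀ a ∈ {a : WithOne T | a ≠ 1 ∧ a ∉ withOneImage φ.srange},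
      ∃ d : T, d ∉ φ.srange ∧ (d : WithOne T) = a := by
    rintro a ⟨ha, haS⟩
    obtain ⟨d, rfl⟩ := WithOne.ne_one_iff_exists.1 ha
    exact ⟨d, fun hd => haS ⟨d, hd, rfl⟩, rfl⟩
  have hempty := eq_empty_of_factorizations (withOneImage φ.srange)
    {a : WithOne T | a ≠ 1 ∧ a ∉ withOneImage φ.srange} (fun _ hx => hx.2)
    (fun a ha => by
      obtain ⟨d, hd, rfl⟩ := hD a ha
      exact exists_factorization_right (hdom d) hd)
    (fun a ha => by
      obtain ⟨d, hd, rfl⟩ := hD a ha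
      exact exists_factorization_left (hdom d) hd)
    (by
      rintro _ ⟨_, ⟨t, rfl⟩, rfl⟩ _ ⟨_, ⟨z, rfl⟩, rfl⟩ _ ⟨_, ⟨x, rfl⟩, rfl⟩ he hf
      -- Idempotents of the image lift to idempotents of `S`, so the law transfers to the image.
      have hid : ∀ s : S, IsIdempotentElem (WithOne.coeMulHom (φ s)) → φ s = φ (omega s) :=
        fun s hs => by
          rw [map_omega, omega_eq_self]
          exact WithOne.coe_inj.1 ((WithOne.coe_mul _ _).trans hs)
      rw [hid t he, hid z hf]
      obtain ⟨n, hn⟩ := omega_eq_posPow (omega t * omega z)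
      have hpow : (WithOne.coeMulHom (φ (omega t)) * WithOne.coeMulHom (φ (omega z))) ^ (n + 1)
          = WithOne.mapMulHom φ ((omega (omega t * omega z) : S) : WithOne S) := by
        rw [hn, coe_posPow, map_pow, WithOne.mapMulHom_coe, map_mul φ, WithOne.coe_mul]
        rfl
      refine ⟨n, ?_, ?_⟩
      · rw [hpow, IsIdempotentElem, ← map_mul, ← WithOne.coe_mul,
          (omega_isIdempotentElem _).eq]
      · obtain ⟨a, b, hab⟩ := hlaw t x z
        rw [hpow]
        refine ⟨WithOne.mapMulHom φ a, WithOne.mapMulHom φ b, ?_⟩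
        calc _ = WithOne.mapMulHom φ ((omega t * x * omega z : S) : WithOne S) := by
              rw [WithOne.mapMulHom_coe, map_mul φ, map_mul φ]
              rfl
          _ = _ := by rw [hab, map_mul, map_mul])
  intro d
  by_contra hd
  have : (d : WithOne T) ∈ {a : WithOne T | a ≠ 1 ∧ a ∉ withOneImage φ.srange} :=
    ⟨WithOne.coe_ne_one, by rintro ⟨s, hs, h⟩; exact hd (WithOne.coe_inj.1 h ▸ hs)⟩
  rw [hempty] at this
  exact this

/-! ### Application to the two pseudovarieties -/

theorem surjective_of_mem_V₂ {S : Semigrp.{u}} (hS : V₂ S) {T : Type u} [Semigroup T] [Finite T]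
    (φ : S →ₙ* T) (hφ : dominion φ.srange = Set.univ) : Function.Surjective φ := by
  obtain ⟨_, hlaw⟩ := hS
  -- The law itself exhibits `e * x * f` as a left multiple of `(e * f)^ω`.
  refine surjective_of_dominion_eq_univ φ hφ fun t x z =>
    ⟨((omega t * x * omega z : S) : WithOne S), 1, ?_⟩
  rw [mul_one, ← WithOne.coe_mul, hlaw]

theorem surjective_of_mem_V₃ {S : Semigrp.{u}} (hS : V₃ S) {T : Type u} [Semigroup T] [Finite T]
    (φ : S →ₙ* T) (hφ : dominion φ.srange = Set.univ) : Function.Surjective φ := by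
  obtain ⟨_, hlaw⟩ := hS
  refine surjective_of_dominion_eq_univ φ hφ fun t x z =>
    ⟨1, ((omega t * x * omega z : S) : WithOne S), ?_⟩
  rw [one_mul, ← WithOne.coe_mul, ← mul_assoc, ← mul_assoc, hlaw]

open scoped CategoryTheory in
theorem dominion_srange_eq_univ_of_epi {S T : Semigrp.{u}} (φ : S ⟶ T) [CategoryTheory.Epi φ] :
    dominion φ.hom.srange = Set.univ := by
  refine Set.eq_univ_of_forall fun d W _ α β h => ?_
  have key : φ ≫ Semigrp.ofHom α = φ ≫ Semigrp.ofHom β := by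
    ext s
    exact h _ ⟨s, rfl⟩
  have := (CategoryTheory.cancel_epi φ).1 key
  exact congrArg (fun ψ : T ⟶ Semigrp.of W => ψ.hom d) this

theorem V₂_of_surjective {S T : Semigrp.{u}} (φ : S →ₙ* T) (hφ : Function.Surjective φ)
    (hS : V₂ S) : V₂ T := by
  obtain ⟨_, hlaw⟩ := hS
  refine ⟨Finite.of_surjective φ hφ, fun t x z => ?_⟩
  have := Finite.of_surjective φ hφ
  obtain ⟨t, rfl⟩ := hφ t
  obtain ⟨x, rfl⟩ := hφ x
  obtain ⟨z, rfl⟩ := hφ z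
  simpa only [map_mul, map_omega] using congrArg φ (hlaw t x z)

theorem V₃_of_surjective {S T : Semigrp.{u}} (φ : S →ₙ* T) (hφ : Function.Surjective φ)
    (hS : V₃ S) : V₃ T := by
  obtain ⟨_, hlaw⟩ := hS
  refine ⟨Finite.of_surjective φ hφ, fun t x z => ?_⟩
  have := Finite.of_surjective φ hφ
  obtain ⟨t, rfl⟩ := hφ t
  obtain ⟨x, rfl⟩ := hφ x
  obtain ⟨z, rfl⟩ := hφ z
  simpa only [map_mul, map_omega] using congrArg φ (hlaw t x z)

end FSat

theorem corollaryc :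
    (FSat.FSaturatedClass FSat.V₂.{u} ∧ FSat.FEpiClosed FSat.V₂.{u}) ∧
      (FSat.FSaturatedClass FSat.V₃.{u} ∧ FSat.FEpiClosed FSat.V₃.{u}) := by
  refine ⟨⟨fun S hS T _ _ ι _ hι hdom => hι (FSat.surjective_of_mem_V₂ hS ι hdom), ?_⟩,
    ⟨fun S hS T _ _ ι _ hι hdom => hι (FSat.surjective_of_mem_V₃ hS ι hdom), ?_⟩⟩
  · intro S T φ _ _ hS
    exact FSat.V₂_of_surjective φ.hom
      (FSat.surjective_of_mem_V₂ hS φ.hom (FSat.dominion_srange_eq_univ_of_epi φ)) hS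
  · intro S T φ _ _ hS
    exact FSat.V₃_of_surjective φ.hom
      (FSat.surjective_of_mem_V₃ hS φ.hom (FSat.dominion_srange_eq_univ_of_epi φ)) hS
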